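/- Let $p$ be a prime and let $\mathbb{C}_p$ be the completion of an algebraic closure of $\mathbb{Q}_p$, with its absolute value $|\cdot|$; for $r>0$ write $D(0,r)=\{t\in\mathbb{C}_p : |t|<r\}\subseteq\mathbb{P}^1(\mathbb{C}_p)$. An open disk in $\mathbb{P}^1(\mathbb{C}_p)$ is a set $\gamma(D(0,r))$ with $r>0$ and $\gamma\in\mathrm{PGL}(2,\mathbb{C}_p)$. An open disk $U$ is called a quasiperiodicity disk for a function $f:U\to U$ if one can write $U=\gamma(D(0,r))$ with $r>0$ and $\gamma\in\mathrm{PGL}(2,\mathbb{C}_p)$ in such a way that on $D(0,r)$ $$\gamma^{-1}\circ f\circ\gamma(t)=\sum_{i\ge 0}c_it^i,\qquad c_i\in\mathbb{C}_p,$$ with $|c_0|<r$, $|c_1|=1$, and $|c_i|r^i\le r$ for all $i\ge 1$. **Theorem.** Let $g\ge 1$. For each $i=1,\ldots,g$, let $U_i$ be an open disk in $\mathbb{P}^1(\mathbb{C}_p)$, and let $f_i:U_i\to U_i$ be a map for which $U_i$ is a quasiperiodicity disk. Let $\Phi=f_1\times\cdots\times f_g$ act on $U_1\times\cdots\times U_g$,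 let $\alpha\in U_1\times\cdots\times U_g$, and let $\mathcal{O}_\Phi(\alpha)=\{\Phi^m(\alpha): m\ge 0\}$ be its orbit. Let $V$ be a (closed) subvariety of $(\mathbb{P}^1)^g$ defined over $\mathbb{C}_p$. Then $V(\mathbb{C}_p)\cap\mathcal{O}_\Phi(\alpha)$ is a union of at most finitely many sets of the form $\{\Phi^{nk+\ell}(\alpha)\}_{n\ge 0}$ with nonnegative integers $k$ and $\ell$. -/

import Mathlib

open scoped LinearAlgebra.Projectivization MatrixGroups

noncomputable section

namespace PadicDynamics

/-- The set `ℙ¹(K)` of `K`-points of the projective line: lines through the origin in `K²`. -/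
abbrev P1 (K : Type*) [Field K] : Type _ := ℙ K (Fin 2 → K)

/-- The inclusion `K ⊆ ℙ¹(K)`, `t ↦ [t : 1]`. -/
def affinePoint {K : Type*} [Field K] (t : K) : P1 K :=
  Projectivization.mk K ![t, 1] (by simp)

section Subvarieties

variable {K : Type*} [Field K] {g : ℕ}

/-- `F` is multihomogeneous of multidegree `d`: for each `i`, it is homogeneous of degree `d i`
in the two homogeneous coordinates `X (i, 0), X (i, 1)` of the `i`-th factor of `(ℙ¹)^g`. -/
def IsMultihomogeneous (F : MvPolynomial (Fin g × Fin 2) K) (d : Fin g → ℕ) : Prop :=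
  F.IsWeightedHomogeneous (fun ij : Fin g × Fin 2 => (Pi.single ij.1 1 : Fin g → ℕ)) d

/-- `F` vanishes at the point `P` of `(ℙ¹)^g`, i.e. at homogeneous coordinates of `P`. For
multihomogeneous `F` the choice of coordinates does not matter, see `vanishesAt_mk_iff`. -/
def VanishesAt (F : MvPolynomial (Fin g × Fin 2) K) (P : Fin g → P1 K) : Prop :=
  MvPolynomial.eval (fun ij : Fin g × Fin 2 => (P ij.1).rep ij.2) F = 0

/-- `V` is (the set of `K`-points of) a Zariski closed subvariety of `(ℙ¹)^g` over `K`: the common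
zero locus of a set of multihomogeneous polynomials with coefficients in `K`. -/
def IsSubvariety (V : Set (Fin g → P1 K)) : Prop :=
  ∃ S : Set (MvPolynomial (Fin g × Fin 2) K),
    (∀ F ∈ S, ∃ d : Fin g → ℕ, IsMultihomogeneous F d) ∧
      V = {P | ∀ F ∈ S, VanishesAt F P}

theorem IsMultihomogeneous.eval_smul {F : MvPolynomial (Fin g × Fin 2) K} {d : Fin g → ℕ}
    (hF : IsMultihomogeneous F d) (a : Fin g → K) (v : Fin g → Fin 2 → K) :
    MvPolynomial.eval (fun ij : Fin g × Fin 2 => a ij.1 * v ij.1 ij.2) F =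
      (∏ i, a i ^ d i) * MvPolynomial.eval (fun ij : Fin g × Fin 2 => v ij.1 ij.2) F := by
  rw [MvPolynomial.eval_eq', MvPolynomial.eval_eq', Finset.mul_sum]
  refine Finset.sum_congr rfl fun m hm => ?_
  have hd := hF (MvPolynomial.mem_support_iff.mp hm)
  have hi : ∀ i, d i = ∑ j, m (i, j) := by
    intro i
    rw [← hd, Finsupp.weight_apply, Finsupp.sum_fintype _ _ (by simp), Finset.sum_apply,
      Fintype.sum_prod_type, Finset.sum_eq_single i]
    · simp
    · intro b _ hb
      simp [hb.symm]
    · simp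
  simp_rw [mul_pow, Finset.prod_mul_distrib]
  have : ∏ ij : Fin g × Fin 2, a ij.1 ^ m ij = ∏ i, a i ^ d i := by
    rw [Fintype.prod_prod_type]
    exact Finset.prod_congr rfl fun i _ => by
      rw [hi i]
      exact Finset.prod_pow_eq_pow_sum Finset.univ (fun j => m (i, j)) (a i)
  rw [this]
  ring

theorem vanishesAt_mk_iff {F : MvPolynomial (Fin g × Fin 2) K} {d : Fin g → ℕ}
    (hF : IsMultihomogeneous F d) (v : Fin g → Fin 2 → K) (hv : ∀ i, v i ≠ 0) :
    VanishesAt F (fun i => Projectivization.mk K (v i) (hv i)) ↔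
      MvPolynomial.eval (fun ij : Fin g × Fin 2 => v ij.1 ij.2) F = 0 := by
  choose a ha using fun i => Projectivization.exists_smul_eq_mk_rep K (v i) (hv i)
  have h := hF.eval_smul (fun i => (a i : K)) v
  have e : (fun ij : Fin g × Fin 2 => (Projectivization.mk K (v ij.1) (hv ij.1)).rep ij.2) =
      fun ij : Fin g × Fin 2 => (a ij.1 : K) * v ij.1 ij.2 := by
    funext ij
    rw [← ha ij.1]
    rfl
  rw [VanishesAt, e, h, mul_eq_zero, or_iff_right]
  exact Finset.prod_ne_zero_iff.mpr fun i _ => pow_ne_zero _ (a i).ne_zero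

end Subvarieties

section Disks

variable {p : ℕ} [Fact p.Prime]

/-- The open disk `γ(D(0, r))` in `ℙ¹(ℂ_p)`. The open disks of `ℙ¹(ℂ_p)` are exactly these sets,
with `r > 0` and `γ` a linear fractional transformation (represented by an invertible matrix). -/
def openDisk (γ : GL (Fin 2) ℂ_[p]) (r : ℝ) : Set (P1 ℂ_[p]) :=
  (fun t : ℂ_[p] => γ • affinePoint t) '' Metric.ball 0 r

/-- `U` is a quasiperiodicity disk for `f : U → U`: for some `r > 0` and some linear fractional
transformation `γ`, `U = γ(D(0, r))` and on `D(0, r)` the map `γ⁻¹ ∘ f ∘ γ` is given by a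
convergent power series `∑ cᵢ tⁱ` with `|c₀| < r`, `|c₁| = 1` and `|cᵢ| rⁱ ≤ r` for `i ≥ 1`. -/
def IsQuasiperiodicityDisk (U : Set (P1 ℂ_[p])) (f : U → U) : Prop :=
  ∃ (r : ℝ) (γ : GL (Fin 2) ℂ_[p]) (c : ℕ → ℂ_[p]),
    0 < r ∧ U = openDisk γ r ∧
    ‖c 0‖ < r ∧ ‖c 1‖ = 1 ∧ (∀ i, 1 ≤ i → ‖c i‖ * r ^ i ≤ r) ∧
    ∀ u : U, ∀ t : ℂ_[p], ‖t‖ < r → (u : P1 ℂ_[p]) = γ • affinePoint t →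
      ∃ s : ℂ_[p], HasSum (fun i => c i * t ^ i) s ∧ (f u : P1 ℂ_[p]) = γ • affinePoint s

end Disks

/-- The `(k, ℓ)`-suborbit `{Φ^{nk+ℓ}(α) : n ≥ 0}` of `α ∈ ∏ Uᵢ` under `Φ : ∏ Uᵢ → ∏ Uᵢ`, as a
subset of `(ℙ¹)^g`. For `(k, ℓ) = (1, 0)` it is the forward orbit of `α`. -/
def suborbit {K : Type*} [Field K] {g : ℕ} {U : Fin g → Set (P1 K)}
    (Φ : (∀ i, U i) → ∀ i, U i) (α : ∀ i, U i) (k l : ℕ) : Set (Fin g → P1 K) :=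
  {P | ∃ n : ℕ, P = fun i => (((Φ^[n * k + l]) α i : U i) : P1 K)}

/-- The forward orbit `{Φ^m(α) : m ≥ 0}`, as a subset of `(ℙ¹)^g`. -/
def orbit {K : Type*} [Field K] {g : ℕ} {U : Fin g → Set (P1 K)}
    (Φ : (∀ i, U i) → ∀ i, U i) (α : ∀ i, U i) : Set (Fin g → P1 K) :=
  {P | ∃ m : ℕ, P = fun i => (((Φ^[m]) α i : U i) : P1 K)}

end PadicDynamics

end

/-! In a coordinate on each disk the orbit is a sequence `x n` with `‖x n‖ ≤ s < r`, generated by a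
power series. On the radius `s` this series is congruent to `c 1 * t` modulo a factor `δ < 1`, and a
power of the unit `c 1` is congruent to 1, so some iterate is congruent to the identity. In terms of
sequences: the difference operator of some step `k` contracts the filtration `gaussBall x s` by a
factor less than 1. Passing from `k` to `p * k` shrinks that factor further
(`IsContracting.mul_natCast`), so it can be made as small as desired.

With factor `p⁻²`, the `m`-th differences of the coordinates along a progression `n * k + l` are
`O(p⁻²ᵐ)`. Such decay survives sums and products, so every polynomial in the coordinates inherits
it. Since `|m!| ≥ p⁻ᵐ`, Newton interpolation writes the values as a series in falling factorials
whose coefficients tend to 0, and a Strassmann-type argument (`finite_zeros_newton`) shows that it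
has finitely many zeros in `ℕ` or vanishes identically. Hence each equation of `V` holds on all, or
on finitely many, terms of each residue class modulo a common step. -/

namespace PadicDynamics

section

open Polynomial fwdDiff

/-! ### Gauss norms along an orbit and contracting difference operators -/

section GaussBall

variable {K : Type*} [NormedField K] {x : ℕ → K} {s η ε δ ρ : ℝ}

/-- The sequences that are uniform limits of sequences `n ↦ P (x n)`, where `P` is a polynomial
whose Gauss norm of radius `s` is at most `η`. -/
def gaussBall (x : ℕ → K) (s η : ℝ) : Set (ℕ → K) :=
  {h | ∀ ε > 0, ∃ P : K[X], (∀ i, ‖P.coeff i‖ * s ^ i ≤ η) ∧ ∀ n, ‖h n - P.eval (x n)‖ ≤ ε}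

theorem eval_mem_gaussBall {P : K[X]} (hP : ∀ i, ‖P.coeff i‖ * s ^ i ≤ η) :
    (fun n => P.eval (x n)) ∈ gaussBall x s η :=
  fun ε hε => ⟨P, hP, fun n => by simpa using hε.le⟩

theorem const_mem_gaussBall (hη : 0 ≤ η) (a : K) (ha : ‖a‖ ≤ η) :
    (fun _ => a) ∈ gaussBall x s η := by
  have := eval_mem_gaussBall (x := x) (s := s) (η := η) (P := C a) fun i => by
    rcases eq_or_ne i 0 with rfl | hi
    · simpa using ha
    · simpa [coeff_C_of_ne_zero hi] using hη
  simpa using this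

theorem zero_mem_gaussBall (hη : 0 ≤ η) : (0 : ℕ → K) ∈ gaussBall x s η :=
  const_mem_gaussBall hη 0 (by simpa using hη)

theorem self_mem_gaussBall (hs : 0 ≤ s) : x ∈ gaussBall x s s := by
  have := eval_mem_gaussBall (x := x) (s := s) (η := s) (P := X) fun i => by
    rcases eq_or_ne i 1 with rfl | hi
    · simp
    · simpa [coeff_X_of_ne_one hi] using hs
  simpa using this

theorem gaussBall_mono (h : η ≤ ε) : gaussBall x s η ⊆ gaussBall x s ε :=
  fun _ hf e he => (hf e he).imp fun _ hP => ⟨fun i => (hP.1 i).trans h, hP.2⟩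

/-- The difference operator of step `k` multiplies the filtration `gaussBall x s` by `δ`. -/
def IsContracting (x : ℕ → K) (s : ℝ) (k : ℕ) (δ : ℝ) : Prop :=
  ∀ η, 0 ≤ η → ∀ h ∈ gaussBall x s η, Δ_[k] h ∈ gaussBall x s (δ * η)

variable {k : ℕ}

theorem IsContracting.mono (h : IsContracting x s k δ) (hδ : δ ≤ ε) : IsContracting x s k ε :=
  fun η hη f hf => gaussBall_mono (mul_le_mul_of_nonneg_right hδ hη) (h η hη f hf)

theorem fwdDiff_mul_step (h : ℕ → K) (j : ℕ) :
    Δ_[j * k] h = ∑ i ∈ Finset.range j, fun n => Δ_[k] h (n + i * k) := by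
  ext n
  rw [Finset.sum_apply]
  have := Finset.sum_range_sub (fun i => h (n + i * k)) j
  simp only [zero_mul, add_zero] at this
  rw [fwdDiff, ← this]
  refine Finset.sum_congr rfl fun i _ => ?_
  simp [fwdDiff, Nat.succ_mul, add_assoc]

theorem IsContracting.iterate_fwdDiff_mem (hk : IsContracting x s k ρ) (hρ : 0 ≤ ρ) (hs : 0 ≤ s) (m : ℕ) :
    (fwdDiff k)^[m] x ∈ gaussBall x s (ρ ^ m * s) := by
  induction m with
  | zero => simpa using self_mem_gaussBall hs
  | succ m ih =>
    rw [Function.iterate_succ_apply', pow_succ', mul_assoc]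
    exact hk _ (by positivity) _ ih

variable [IsUltrametricDist K]

/-- Closure under uniform limits; this reduces later claims to honest polynomials. -/
theorem mem_gaussBall_of_forall_approx {h : ℕ → K}
    (H : ∀ ε > 0, ∃ h' ∈ gaussBall x s η, ∀ n, ‖h n - h' n‖ ≤ ε) : h ∈ gaussBall x s η := by
  intro ε hε
  obtain ⟨h', hh', hd⟩ := H ε hε
  obtain ⟨P, hP, hPd⟩ := hh' ε hε
  refine ⟨P, hP, fun n => ?_⟩
  rw [show h n - P.eval (x n) = (h n - h' n) + (h' n - P.eval (x n)) by ring]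
  exact (IsUltrametricDist.norm_add_le_max _ _).trans (max_le (hd n) (hPd n))

theorem add_mem_gaussBall (hs : 0 ≤ s) {h h' : ℕ → K} (hh : h ∈ gaussBall x s η)
    (hh' : h' ∈ gaussBall x s η) : h + h' ∈ gaussBall x s η := by
  intro ε hε
  obtain ⟨P, hP, hPd⟩ := hh ε hε
  obtain ⟨Q, hQ, hQd⟩ := hh' ε hε
  refine ⟨P + Q, fun i => ?_, fun n => ?_⟩
  · rw [coeff_add]
    refine (mul_le_mul_of_nonneg_right (IsUltrametricDist.norm_add_le_max _ _)
      (by positivity)).trans ?_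
    rw [max_mul_of_nonneg _ _ (by positivity)]
    exact max_le (hP i) (hQ i)
  · rw [eval_add, Pi.add_apply, add_sub_add_comm]
    exact (IsUltrametricDist.norm_add_le_max _ _).trans (max_le (hPd n) (hQd n))

theorem sum_mem_gaussBall (hs : 0 ≤ s) (hη : 0 ≤ η) {ι : Type*} (t : Finset ι)
    (h : ι → ℕ → K) (hh : ∀ i ∈ t, h i ∈ gaussBall x s η) :
    ∑ i ∈ t, h i ∈ gaussBall x s η :=
  Finset.sum_induction _ (· ∈ gaussBall x s η) (fun _ _ => add_mem_gaussBall hs)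
    (zero_mem_gaussBall hη) hh

theorem norm_eval_le_of_coeff (hη : 0 ≤ η) {P : K[X]} (hP : ∀ i, ‖P.coeff i‖ * s ^ i ≤ η)
    {t : K} (ht : ‖t‖ ≤ s) : ‖P.eval t‖ ≤ η := by
  rw [eval_eq_sum_range]
  refine IsUltrametricDist.norm_sum_le_of_forall_le_of_nonneg hη fun i _ => ?_
  rw [norm_mul, norm_pow]
  exact (mul_le_mul_of_nonneg_left (pow_le_pow_left₀ (norm_nonneg _) ht i)
    (norm_nonneg _)).trans (hP i)

theorem norm_le_of_mem_gaussBall (hx : ∀ n, ‖x n‖ ≤ s) (hη : 0 ≤ η) {h : ℕ → K}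
    (hh : h ∈ gaussBall x s η) (n : ℕ) : ‖h n‖ ≤ η := by
  refine le_of_forall_pos_le_add fun ε hε => ?_
  obtain ⟨P, hP, hPd⟩ := hh ε hε
  rw [show h n = (h n - P.eval (x n)) + P.eval (x n) by ring]
  refine (norm_add_le _ _).trans ?_
  linarith [hPd n, norm_eval_le_of_coeff hη hP (hx n)]

/-- The Gauss norm is submultiplicative over an ultrametric field. -/
theorem mul_mem_gaussBall (hs : 0 ≤ s) (hx : ∀ n, ‖x n‖ ≤ s) (hη : 0 ≤ η) (hε : 0 ≤ ε)
    {h h' : ℕ → K} (hh : h ∈ gaussBall x s η) (hh' : h' ∈ gaussBall x s ε) :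
    h * h' ∈ gaussBall x s (η * ε) := by
  intro e he
  -- The error of the product is at most `d * ε + η * d`, which this choice keeps below `e`; the 1
  -- keeps the denominator positive.
  set d := e / (η + ε + 1)
  have hd : 0 < d := by positivity
  have hde : d * (η + ε + 1) = e := div_mul_cancel₀ _ (by positivity)
  obtain ⟨P, hP, hPd⟩ := hh d hd
  obtain ⟨Q, hQ, hQd⟩ := hh' d hd
  refine ⟨P * Q, fun i => ?_, fun n => ?_⟩
  · rw [coeff_mul]
    obtain ⟨j, hj, hle⟩ := IsUltrametricDist.exists_norm_finsetSum_le_of_nonempty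
      (t := Finset.HasAntidiagonal.antidiagonal i) ⟨(0, i), by simp⟩ fun y => P.coeff y.1 * Q.coeff y.2
    refine (mul_le_mul_of_nonneg_right hle (by positivity)).trans ?_
    rw [Finset.HasAntidiagonal.mem_antidiagonal] at hj
    rw [← hj, norm_mul, pow_add, mul_mul_mul_comm]
    exact mul_le_mul (hP _) (hQ _) (by positivity) hη
  · rw [eval_mul, Pi.mul_apply, show h n * h' n - P.eval (x n) * Q.eval (x n) =
      (h n - P.eval (x n)) * h' n + P.eval (x n) * (h' n - Q.eval (x n)) by ring]
    refine (norm_add_le _ _).trans ?_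
    rw [norm_mul, norm_mul]
    have h1 := mul_le_mul (hPd n) (norm_le_of_mem_gaussBall hx hε hh' n) (norm_nonneg _) hd.le
    have h2 := mul_le_mul (norm_eval_le_of_coeff hη hP (hx n)) (hQd n) (norm_nonneg _) hη
    nlinarith

theorem smul_mem_gaussBall (hs : 0 ≤ s) (hx : ∀ n, ‖x n‖ ≤ s) (hη : 0 ≤ η) (a : K)
    {h : ℕ → K} (hh : h ∈ gaussBall x s η) : (fun n => a * h n) ∈ gaussBall x s (‖a‖ * η) :=
  mul_mem_gaussBall hs hx (norm_nonneg a) hη (const_mem_gaussBall (norm_nonneg a) a le_rfl) hh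

theorem pow_mem_gaussBall (hs : 0 ≤ s) (hx : ∀ n, ‖x n‖ ≤ s) (hη : 0 ≤ η) {h : ℕ → K}
    (hh : h ∈ gaussBall x s η) (i : ℕ) : h ^ i ∈ gaussBall x s (η ^ i) := by
  induction i with
  | zero =>
    rw [pow_zero, pow_zero]
    exact const_mem_gaussBall zero_le_one 1 (by simp)
  | succ i ih =>
    rw [pow_succ, pow_succ]
    exact mul_mem_gaussBall hs hx (by positivity) hη ih hh

theorem pow_sub_pow_mem_gaussBall (hs : 0 ≤ s) (hx : ∀ n, ‖x n‖ ≤ s) (hδ : 0 ≤ δ) {y : ℕ → K}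
    (hy : y ∈ gaussBall x s s) (hyx : y - x ∈ gaussBall x s (δ * s)) (i : ℕ) :
    y ^ i - x ^ i ∈ gaussBall x s (δ * s ^ i) := by
  induction i with
  | zero => simpa using zero_mem_gaussBall hδ
  | succ i ih =>
    rw [show y ^ (i + 1) - x ^ (i + 1) = y ^ i * (y - x) + (y ^ i - x ^ i) * x by ring]
    refine add_mem_gaussBall hs ?_ ?_
    · rw [show δ * s ^ (i + 1) = s ^ i * (δ * s) by ring]
      exact mul_mem_gaussBall hs hx (by positivity) (by positivity)
        (pow_mem_gaussBall hs hx hs hy i) hyx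
    · rw [pow_succ, ← mul_assoc]
      exact mul_mem_gaussBall hs hx (by positivity) hs ih (self_mem_gaussBall hs)

/-- Shifting substitutes the `k`-th iterate into `P`; an iterate of Gauss norm at most `s` does not
increase the bound on `P`. -/
theorem shift_mem_gaussBall (hs : 0 ≤ s) (hx : ∀ n, ‖x n‖ ≤ s)
    (hk : (fun n => x (n + k)) ∈ gaussBall x s s) (hη : 0 ≤ η) {h : ℕ → K}
    (hh : h ∈ gaussBall x s η) : (fun n => h (n + k)) ∈ gaussBall x s η := by
  refine mem_gaussBall_of_forall_approx fun ε hε => ?_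
  obtain ⟨P, hP, hPd⟩ := hh ε hε
  refine ⟨_, ?_, fun n => hPd (n + k)⟩
  have : (fun n => P.eval (x (n + k))) = ∑ i ∈ Finset.range (P.natDegree + 1),
      fun n => P.coeff i * ((fun n => x (n + k)) ^ i) n := by
    ext n
    simp [eval_eq_sum_range]
  rw [this]
  refine sum_mem_gaussBall hs hη _ _ fun i _ => gaussBall_mono (hP i) ?_
  exact smul_mem_gaussBall hs hx (by positivity) _ (pow_mem_gaussBall hs hx hs hk i)

/-- By linearity it is enough to treat monomials, where `y ^ i - x ^ i` gains the factor `δ` carried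
by `y - x`. This uses bounds on coefficients, which a sup norm over the orbit would not supply. -/
theorem isContracting_of_sub_mem (hs : 0 ≤ s) (hx : ∀ n, ‖x n‖ ≤ s) (hδ : 0 ≤ δ)
    (hk : (fun n => x (n + k)) ∈ gaussBall x s s)
    (hkx : (fun n => x (n + k)) - x ∈ gaussBall x s (δ * s)) : IsContracting x s k δ := by
  intro η hη h hh
  refine mem_gaussBall_of_forall_approx fun ε hε => ?_
  obtain ⟨P, hP, hPd⟩ := hh ε hε
  refine ⟨fun n => P.eval (x (n + k)) - P.eval (x n), ?_, fun n => ?_⟩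
  · have : (fun n => P.eval (x (n + k)) - P.eval (x n)) = ∑ i ∈ Finset.range (P.natDegree + 1),
        fun n => P.coeff i * ((fun n => x (n + k)) ^ i - x ^ i : ℕ → K) n := by
      ext n
      simp [eval_eq_sum_range, mul_sub]
    rw [this]
    refine sum_mem_gaussBall hs (by positivity) _ _ fun i _ =>
      gaussBall_mono (mul_le_mul_of_nonneg_left (hP i) hδ) ?_
    rw [mul_left_comm]
    exact smul_mem_gaussBall hs hx (by positivity) _ (pow_sub_pow_mem_gaussBall hs hx hδ hk hkx i)
  · rw [fwdDiff, sub_sub_sub_comm, sub_eq_add_neg]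
    refine (IsUltrametricDist.norm_add_le_max _ _).trans ?_
    rw [norm_neg]
    exact max_le (hPd _) (hPd _)

namespace IsContracting

theorem shift_mem (hs : 0 ≤ s) (hk : IsContracting x s k δ) (hδ : δ ≤ 1) (hη : 0 ≤ η)
    {h : ℕ → K} (hh : h ∈ gaussBall x s η) (j : ℕ) :
    (fun n => h (n + j * k)) ∈ gaussBall x s η := by
  induction j with
  | zero => simpa using hh
  | succ j ih =>
    have := add_mem_gaussBall hs
      (gaussBall_mono (mul_le_of_le_one_left hη hδ) (hk η hη _ ih)) ih
    convert this using 1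
    ext n
    simp [fwdDiff, Nat.succ_mul, add_right_comm, ← add_assoc]

theorem mul_left (hs : 0 ≤ s) (hk : IsContracting x s k δ) (hδ0 : 0 ≤ δ) (hδ : δ ≤ 1) (j : ℕ) :
    IsContracting x s (j * k) δ := by
  intro η hη h hh
  rw [fwdDiff_mul_step]
  exact sum_mem_gaussBall hs (by positivity) _ _ fun i _ =>
    hk.shift_mem hs hδ (by positivity) (hk η hη h hh) i

/-- With `w = Δ_[k] h`, the difference of step `p * k` is the sum of the shifts of `w` by `i * k`,
that is, `p * w` plus the sum of the `Δ_[i * k] w`. The first part gains `‖p‖`, the second a further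
`δ`. -/
theorem mul_natCast (hs : 0 ≤ s) (hx : ∀ n, ‖x n‖ ≤ s) (hk : IsContracting x s k δ)
    (hδ0 : 0 ≤ δ) (hδ : δ ≤ 1) (p : ℕ) :
    IsContracting x s (p * k) (δ * max ‖(p : K)‖ δ) := by
  intro η hη h hh
  have hw := hk η hη h hh
  have : Δ_[p * k] h = (fun n => (p : K) * Δ_[k] h n) +
      ∑ i ∈ Finset.range p, Δ_[i * k] (Δ_[k] h) := by
    rw [fwdDiff_mul_step]
    ext n
    set w := Δ_[k] h
    simp only [Finset.sum_apply, Pi.add_apply, fwdDiff, Finset.sum_sub_distrib,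
      Finset.sum_const, Finset.card_range, nsmul_eq_mul, add_sub_cancel]
  rw [this, show δ * max ‖(p : K)‖ δ * η = max ‖(p : K)‖ δ * (δ * η) by ring]
  have hη' : 0 ≤ δ * η := by positivity
  refine add_mem_gaussBall hs (gaussBall_mono ?_ (smul_mem_gaussBall hs hx hη' _ hw))
    (sum_mem_gaussBall hs (by positivity) _ _ fun i _ => gaussBall_mono ?_
      (hk.mul_left hs hδ0 hδ i _ hη' _ hw))
  · exact mul_le_mul_of_nonneg_right (le_max_left _ _) hη'
  · exact mul_le_mul_of_nonneg_right (le_max_right _ _) hη'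

theorem mul_natCast_pow (hs : 0 ≤ s) (hx : ∀ n, ‖x n‖ ≤ s) (hk : IsContracting x s k δ)
    (hδ0 : 0 ≤ δ) (hδ : δ ≤ 1) (p N : ℕ) :
    IsContracting x s (p ^ N * k) (δ * max ‖(p : K)‖ δ ^ N) := by
  have hp : ‖(p : K)‖ ≤ 1 := IsUltrametricDist.norm_natCast_le_one K p
  have hm1 : max ‖(p : K)‖ δ ≤ 1 := max_le hp hδ
  have hm0 : 0 ≤ max ‖(p : K)‖ δ := hδ0.trans (le_max_right _ _)
  induction N with
  | zero => simpa using hk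
  | succ N ih =>
    have hle : δ * max ‖(p : K)‖ δ ^ N ≤ δ := mul_le_of_le_one_right hδ0 (pow_le_one₀ hm0 hm1)
    have := ih.mul_natCast hs hx (by positivity) (hle.trans hδ) p
    rw [← mul_assoc, ← pow_succ'] at this
    refine this.mono ?_
    rw [pow_succ, ← mul_assoc]
    exact mul_le_mul_of_nonneg_left (max_le_max_left _ hle) (by positivity)

theorem exists_contracting_le (hs : 0 ≤ s) (hx : ∀ n, ‖x n‖ ≤ s) (hk : IsContracting x s k δ)
    (hδ0 : 0 ≤ δ) (hδ : δ < 1) (hk0 : 0 < k) {p : ℕ} (hp0 : 0 < p) (hp : ‖(p : K)‖ < 1)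
    (hρ : 0 < ρ) : ∃ k' > 0, IsContracting x s k' ρ := by
  obtain ⟨N, hN⟩ := exists_pow_lt_of_lt_one hρ (max_lt hp hδ)
  refine ⟨p ^ N * k, by positivity, (hk.mul_natCast_pow hs hx hδ0 hδ.le p N).mono ?_⟩
  have h0 : 0 ≤ max ‖(p : K)‖ δ ^ N := pow_nonneg (hδ0.trans (le_max_right _ _)) N
  exact (mul_le_of_le_one_left h0 hδ.le).trans hN.le

end IsContracting

end GaussBall

/-! ### Sequences with geometrically decaying differences -/

section DiffDecay

variable {K : Type*} [NormedField K] {ρ : ℝ}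

theorem iterate_fwdDiff_comp_mul_add (h : ℕ → K) (k l m : ℕ) :
    (fwdDiff 1)^[m] (fun n => h (n * k + l)) = fun n => (fwdDiff k)^[m] h (n * k + l) := by
  induction m with
  | zero => rfl
  | succ m ih =>
    rw [Function.iterate_succ_apply', Function.iterate_succ_apply', ih]
    ext n
    simp [fwdDiff, Nat.succ_mul, add_right_comm]

/-- The `m`-th differences of `a` are bounded by a multiple of `ρ ^ m`. -/
def DiffDecay (ρ : ℝ) (a : ℕ → K) : Prop :=
  ∃ C, 0 ≤ C ∧ ∀ m n, ‖(fwdDiff 1)^[m] a n‖ ≤ C * ρ ^ m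

theorem DiffDecay.const (hρ : 0 ≤ ρ) (c : K) : DiffDecay ρ fun _ => c := by
  refine ⟨‖c‖, norm_nonneg c, fun m n => ?_⟩
  cases m with
  | zero => simp
  | succ m =>
    have : (fwdDiff 1)^[m + 1] (fun _ : ℕ => c) n = 0 := by
      rw [Function.iterate_succ_apply, fwdDiff_const,
        Function.iterate_fixed (fwdDiff_const (h := 1) (0 : K))]
    rw [this, norm_zero]
    positivity

variable [IsUltrametricDist K]

theorem DiffDecay.add (hρ : 0 ≤ ρ) {a b : ℕ → K} (ha : DiffDecay ρ a) (hb : DiffDecay ρ b) :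
    DiffDecay ρ (a + b) := by
  obtain ⟨A, hA, ha⟩ := ha
  obtain ⟨B, hB, hb⟩ := hb
  refine ⟨max A B, le_max_of_le_left hA, fun m n => ?_⟩
  rw [fwdDiff_iter_add, Pi.add_apply, max_mul_of_nonneg _ _ (by positivity)]
  exact (IsUltrametricDist.norm_add_le_max _ _).trans (max_le_max (ha m n) (hb m n))

/-- The Leibniz rule `Δ(ab) = Δa · b + (shift a) · Δb` moves one factor `ρ` into a constant, so the
induction must let `A`, `B`, `a`, `b` vary. The ultrametric inequality avoids binomial factors. -/
theorem norm_iterate_fwdDiff_mul_le (hρ : 0 ≤ ρ) (m : ℕ) : ∀ {A B : ℝ} {a b : ℕ → K}, 0 ≤ A →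
    0 ≤ B → (∀ m n, ‖(fwdDiff 1)^[m] a n‖ ≤ A * ρ ^ m) → (∀ m n, ‖(fwdDiff 1)^[m] b n‖ ≤ B * ρ ^ m) →
    ∀ n, ‖(fwdDiff 1)^[m] (a * b) n‖ ≤ A * B * ρ ^ m := by
  induction m with
  | zero =>
    intro A B a b hA hB ha hb n
    simpa using mul_le_mul (ha 0 n) (hb 0 n) (norm_nonneg _) (by positivity)
  | succ m ih =>
    intro A B a b hA hB ha hb n
    have h1 : Δ_[1] (a * b) = Δ_[1] a * b + (fun n => a (n + 1)) * Δ_[1] b := by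
      ext n
      simp only [fwdDiff, Pi.mul_apply, Pi.add_apply]
      ring
    have hda : ∀ m n, ‖(fwdDiff 1)^[m] (Δ_[1] a) n‖ ≤ A * ρ * ρ ^ m := fun m n => by
      simpa [pow_succ', mul_assoc] using ha (m + 1) n
    have hdb : ∀ m n, ‖(fwdDiff 1)^[m] (Δ_[1] b) n‖ ≤ B * ρ * ρ ^ m := fun m n => by
      simpa [pow_succ', mul_assoc] using hb (m + 1) n
    have hsa : ∀ m n, ‖(fwdDiff 1)^[m] (fun n => a (n + 1)) n‖ ≤ A * ρ ^ m := fun m n => by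
      rw [fwdDiff_iter_comp_add]
      exact ha m (n + 1)
    rw [Function.iterate_succ_apply, h1, fwdDiff_iter_add, Pi.add_apply]
    refine (IsUltrametricDist.norm_add_le_max _ _).trans (max_le ?_ ?_)
    · exact (ih (by positivity) hB hda hb n).trans (le_of_eq (by ring))
    · exact (ih hA (by positivity) hsa hdb n).trans (le_of_eq (by ring))

theorem DiffDecay.mul (hρ : 0 ≤ ρ) {a b : ℕ → K} (ha : DiffDecay ρ a) (hb : DiffDecay ρ b) :
    DiffDecay ρ (a * b) := by
  obtain ⟨A, hA, ha⟩ := ha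
  obtain ⟨B, hB, hb⟩ := hb
  exact ⟨A * B, by positivity, fun m => norm_iterate_fwdDiff_mul_le hρ m hA hB ha hb⟩

theorem DiffDecay.mvPolynomial_eval (hρ : 0 ≤ ρ) {σ : Type*} {a : σ → ℕ → K}
    (ha : ∀ i, DiffDecay ρ (a i)) (F : MvPolynomial σ K) :
    DiffDecay ρ fun n => MvPolynomial.eval (fun i => a i n) F := by
  induction F using MvPolynomial.induction_on with
  | C c => simpa using DiffDecay.const hρ c
  | add P Q hP hQ =>
    simp only [map_add]
    exact hP.add hρ hQ
  | mul_X P i hP =>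
    simp only [map_mul, MvPolynomial.eval_X]
    exact hP.mul hρ (ha i)

theorem IsContracting.diffDecay {x : ℕ → K} {s : ℝ} {k : ℕ} (hs : 0 ≤ s)
    (hx : ∀ n, ‖x n‖ ≤ s) (hρ : 0 ≤ ρ) (hk : IsContracting x s k ρ) (l : ℕ) :
    DiffDecay ρ fun n => x (n * k + l) := by
  refine ⟨s, hs, fun m n => ?_⟩
  rw [iterate_fwdDiff_comp_mul_add, mul_comm]
  exact norm_le_of_mem_gaussBall hx (by positivity) (hk.iterate_fwdDiff_mem hρ hs m) _

end DiffDecay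

/-! ### Zeros of Newton series -/

section Newton

variable {K : Type*} [NormedField K] [IsUltrametricDist K] [CharZero K]

/-- A Newton series whose coefficients tend to zero in a nonarchimedean field vanishes at finitely
many natural numbers, unless its coefficients are all zero. -/
theorem finite_zeros_newton {d : ℕ → K} (hd : Filter.Tendsto d Filter.atTop (nhds 0))
    {m₀ : ℕ} (h0 : d m₀ ≠ 0) :
    {n : ℕ | ∑ m ∈ Finset.range (n + 1), d m * (n.descFactorial m : K) = 0}.Finite := by
  -- `M` is the last index whose coefficient is at least as large as `d m₀`. The rest shows that
  -- there are at most `M` zeros.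
  obtain ⟨M, hM0, hM⟩ : ∃ M, d M ≠ 0 ∧ ∀ m > M, ‖d m‖ < ‖d M‖ := by
    have hfin : {m | ‖d m₀‖ ≤ ‖d m‖}.Finite := by
      have := (hd.norm.eventually_lt_const (by simpa using h0 : ‖(0 : K)‖ < ‖d m₀‖))
      rw [← Nat.cofinite_eq_atTop, Filter.eventually_cofinite] at this
      simpa using this
    obtain ⟨M, hM, hmax⟩ := Set.exists_max_image _ id hfin ⟨m₀, le_refl ‖d m₀‖⟩
    refine ⟨M, norm_pos_iff.mp ((norm_pos_iff.mpr h0).trans_le hM), fun m hm => ?_⟩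
    by_contra hlt
    exact absurd (hmax m (le_trans hM (not_lt.mp hlt))) (not_le.mpr hm)
  by_contra hinf
  obtain ⟨t, ht, htc⟩ := Set.Infinite.exists_subset_card_eq hinf (M + 1)
  set Q : ℤ[X] := ∏ i ∈ t, (X - C (i : ℤ)) with hQ
  have hQm : Q.Monic := monic_prod_of_monic _ _ fun i _ => monic_X_sub_C _
  have hQd : Q.natDegree = M + 1 := by
    rw [hQ, natDegree_prod_of_monic _ _ fun i _ => monic_X_sub_C _]
    simp only [natDegree_X_sub_C, Finset.sum_const, htc, smul_eq_mul, mul_one]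
  -- Dividing by the monic integral `Q` keeps the values at the `M + 1` chosen zeros, lowers the
  -- degree to at most `M`, and leaves integer coefficients, which have norm at most 1.
  set R : ℕ → ℤ[X] := fun m => descPochhammer ℤ m %ₘ Q with hR
  have hRd : ∀ m, (R m).natDegree < M + 1 := fun m =>
    hQd ▸ natDegree_modByMonic_lt _ hQm (by rintro h; simp [h] at hQd)
  have hRe : ∀ m, ∀ i ∈ t, (R m).eval (i : ℤ) = (i.descFactorial m : ℤ) := fun m i hi => by
    have h := congrArg (eval (i : ℤ)) (modByMonic_add_div (descPochhammer ℤ m) Q)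
    have hz : Q.eval (i : ℤ) = 0 := by
      rw [hQ, eval_prod]
      exact Finset.prod_eq_zero hi (by simp)
    rw [eval_add, eval_mul, hz, zero_mul, add_zero] at h
    rw [hR, h]
    exact descPochhammer_eval_eq_descFactorial ℤ i m
  have hRlow : ∀ m ≤ M, R m = descPochhammer ℤ m := fun m hm => by
    rw [hR]
    refine (modByMonic_eq_self_iff hQm).mpr (degree_lt_degree ?_)
    rw [descPochhammer_natDegree, hQd]
    omega
  -- Large enough that truncation at `N` changes no value on `t` and still includes index `M`.
  set N := M + t.sup id with hN
  set A : K[X] := ∑ m ∈ Finset.range (N + 1), C (d m) * (R m).map (Int.castRingHom K) with hA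
  have hA0 : A = 0 := by
    refine eq_zero_of_natDegree_lt_card_of_eval_eq_zero' A (t.map Nat.castEmbedding) ?_ ?_
    · simp only [Finset.mem_map, Nat.castEmbedding_apply, forall_exists_index, and_imp,
        forall_apply_eq_imp_iff₂]
      intro i hi
      have hz : ∑ m ∈ Finset.range (i + 1), d m * (i.descFactorial m : K) = 0 := ht hi
      have hiN : i ≤ N := (Finset.le_sup (f := id) hi).trans (Nat.le_add_left _ _)
      rw [hA, eval_finsetSum, ← hz]
      have hev : ∀ m, ((R m).map (Int.castRingHom K)).eval (i : K) = (i.descFactorial m : K) := by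
        intro m
        have := eval_natCast_map (Int.castRingHom K) (R m) i
        rw [this, hRe m i hi]
        simp
      simp only [eval_mul, eval_C, hev]
      refine (Finset.sum_subset (Finset.range_subset_range.mpr (by omega)) fun m _ hm => ?_).symm
      rw [Nat.descFactorial_of_lt (by simpa using hm)]
      simp
    · rw [Finset.card_map, htc]
      refine Nat.lt_succ_of_le (natDegree_sum_le_of_forall_le _ _ fun m _ => ?_)
      refine (natDegree_C_mul_le _ _).trans (natDegree_map_le.trans ?_)
      exact Nat.lt_succ_iff.mp (hRd m)
  -- Falling factorials of degree at most `M` are unchanged by the reduction, so below `M` nothing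
  -- contributes and `M` contributes exactly `d M`. The remaining terms are strictly smaller,
  -- contradicting `A = 0`.
  have hc : A.coeff M = d M + ∑ m ∈ Finset.Ico (M + 1) (N + 1), d m * ((R m).coeff M : K) := by
    rw [hA, finsetSum_coeff, ← Finset.sum_range_add_sum_Ico _ (show M + 1 ≤ N + 1 by omega),
      Finset.sum_range_succ, Finset.sum_eq_zero]
    · have hl : (R M).coeff M = 1 := by
        rw [hRlow M le_rfl]
        have := monic_descPochhammer ℤ M
        rwa [Monic, leadingCoeff, descPochhammer_natDegree] at this
      simp [hl]
    · intro m hm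
      have hm := Finset.mem_range.mp hm
      have : (R m).coeff M = 0 := by
        rw [hRlow m hm.le]
        exact coeff_eq_zero_of_natDegree_lt (by rwa [descPochhammer_natDegree])
      simp [this]
  rw [hA0, coeff_zero] at hc
  have hlt : ‖∑ m ∈ Finset.Ico (M + 1) (N + 1), d m * ((R m).coeff M : K)‖ < ‖d M‖ := by
    rcases (Finset.Ico (M + 1) (N + 1)).eq_empty_or_nonempty with he | hne
    · rw [he]
      simpa using hM0
    · obtain ⟨m, hm, hle⟩ := IsUltrametricDist.exists_norm_finsetSum_le_of_nonempty hne
        fun m => d m * ((R m).coeff M : K)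
      refine hle.trans_lt ?_
      rw [norm_mul]
      refine (mul_le_of_le_one_right (norm_nonneg _)
        (IsUltrametricDist.norm_intCast_le_one K _)).trans_lt (hM m ?_)
      have := (Finset.mem_Ico.mp hm).1
      omega
  rw [← norm_neg, ← eq_neg_of_add_eq_zero_left hc.symm] at hlt
  exact lt_irrefl _ hlt

/-- Newton's formula in falling factorials has coefficients `Δᵐa(0) / m!`, of size `O((ρ / q) ^ m)`;
hence the need for `ρ < q`. -/
theorem DiffDecay.eq_zero_or_finite_zeros {q ρ : ℝ} (hq : 0 < q)
    (hfac : ∀ m : ℕ, q ^ m ≤ ‖(m.factorial : K)‖) (hρ : 0 ≤ ρ) (hρq : ρ < q) {a : ℕ → K}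
    (ha : DiffDecay ρ a) : (∀ n, a n = 0) ∨ {n | a n = 0}.Finite := by
  obtain ⟨A, hA, ha⟩ := ha
  set d : ℕ → K := fun m => (fwdDiff 1)^[m] a 0 / (m.factorial : K) with hd
  have hsum : ∀ n, a n = ∑ m ∈ Finset.range (n + 1), d m * (n.descFactorial m : K) := by
    intro n
    have := shift_eq_sum_fwdDiff_iter 1 a n 0
    rw [smul_eq_mul, mul_one, zero_add] at this
    rw [this]
    refine Finset.sum_congr rfl fun m _ => ?_
    have hm : (m.factorial : K) ≠ 0 := Nat.cast_ne_zero.mpr m.factorial_ne_zero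
    rw [hd, Nat.descFactorial_eq_factorial_mul_choose, nsmul_eq_mul]
    push_cast
    field_simp
  have hlim : Filter.Tendsto d Filter.atTop (nhds 0) := by
    refine squeeze_zero_norm (a := fun m => A * (ρ / q) ^ m) (fun m => ?_) ?_
    · rw [hd, norm_div, div_pow, ← mul_div_assoc]
      exact div_le_div₀ (by positivity) (ha m 0) (by positivity) (hfac m)
    · simpa using (tendsto_pow_atTop_nhds_zero_of_lt_one (by positivity)
        ((div_lt_one hq).mpr hρq)).const_mul A
  by_cases h : ∃ m, d m ≠ 0
  · obtain ⟨m, hm⟩ := h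
    right
    simpa only [← hsum] using finite_zeros_newton hlim hm
  · left
    push Not at h
    intro n
    rw [hsum]
    simp [h]

end Newton

/-! ### Orbits of quasiperiodic power series -/

section PowerSeriesOrbit

variable {K : Type*} [NormedField K] {c : ℕ → K} {r s : ℝ}

theorem norm_coeff_mul_pow_le (hr : 0 < r) (hs : 0 ≤ s)
    (hc : ∀ i, 1 ≤ i → ‖c i‖ * r ^ i ≤ r) {i : ℕ} (hi : 1 ≤ i) :
    ‖c i‖ * s ^ i ≤ r * (s / r) ^ i := by
  have h := mul_le_mul_of_nonneg_right (hc i hi) (show 0 ≤ (s / r) ^ i by positivity)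
  rwa [mul_assoc, ← mul_pow, mul_div_cancel₀ _ hr.ne'] at h

theorem mul_div_pow_le (hr : 0 < r) (hs : 0 ≤ s) (hsr : s ≤ r) {i : ℕ} (hi : 1 ≤ i) :
    r * (s / r) ^ i ≤ s := by
  have h : (s / r) ^ i ≤ (s / r) ^ 1 :=
    pow_le_pow_of_le_one (by positivity) ((div_le_one hr).mpr hsr) hi
  calc r * (s / r) ^ i ≤ r * (s / r) ^ 1 := mul_le_mul_of_nonneg_left h hr.le
    _ = s := by rw [pow_one, mul_div_cancel₀ _ hr.ne']

theorem norm_term_le {t : K} (ht : ‖t‖ ≤ s) (i : ℕ) : ‖c i * t ^ i‖ ≤ ‖c i‖ * s ^ i := by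
  rw [norm_mul, norm_pow]
  exact mul_le_mul_of_nonneg_left (pow_le_pow_left₀ (norm_nonneg _) ht i) (norm_nonneg _)

variable [IsUltrametricDist K]

theorem norm_le_of_hasSum {f : ℕ → K} {a : K} (h : HasSum f a) {C : ℝ} (hf : ∀ i, ‖f i‖ ≤ C) :
    ‖a‖ ≤ C :=
  h.tsum_eq ▸ IsUltrametricDist.norm_tsum_le_of_forall_le hf

theorem norm_powerSeries_le (hr : 0 < r) (hs : 0 ≤ s) (hsr : s ≤ r) (hc0 : ‖c 0‖ ≤ s)
    (hc : ∀ i, 1 ≤ i → ‖c i‖ * r ^ i ≤ r) {t u : K} (ht : ‖t‖ ≤ s)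
    (h : HasSum (fun i => c i * t ^ i) u) : ‖u‖ ≤ s := by
  refine norm_le_of_hasSum h fun i => (norm_term_le ht i).trans ?_
  rcases Nat.eq_zero_or_pos i with rfl | hi
  · simpa using hc0
  · exact (norm_coeff_mul_pow_le hr hs hc hi).trans (mul_div_pow_le hr hs hsr hi)

variable {x : ℕ → K} {δ : ℝ}

/-- Shrinking the radius from `r` to `s` bounds the term of degree `i ≥ 2` by `r * (s / r) ^ i ≤ (s
/ r) * s`; the constant term is covered by `hδ0`. -/
theorem shift_sub_smul_mem_gaussBall (hr : 0 < r) (hs : 0 < s) (hsr : s < r)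
    (hc : ∀ i, 1 ≤ i → ‖c i‖ * r ^ i ≤ r) (hx : ∀ n, ‖x n‖ ≤ s)
    (hsum : ∀ n, HasSum (fun i => c i * x n ^ i) (x (n + 1)))
    (hδ0 : ‖c 0‖ ≤ δ * s) (hδ : s / r ≤ δ) :
    (fun n => x (n + 1) - c 1 * x n) ∈ gaussBall x s (δ * s) := by
  have hδ' : 0 ≤ δ := le_trans (by positivity) hδ
  have hsr1 : s / r < 1 := (div_lt_one hr).mpr hsr
  refine mem_gaussBall_of_forall_approx fun ε hε => ?_
  obtain ⟨N, hN⟩ := exists_pow_lt_of_lt_one (div_pos hε hr) hsr1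
  -- At least 2, so that the linear term lies in the truncated part.
  set M := N + 2
  set c' : ℕ → K := fun i => if i = 1 then 0 else c i with hc'
  refine ⟨∑ i ∈ Finset.range M, fun n => c' i * (x ^ i) n, ?_, fun n => ?_⟩
  · refine sum_mem_gaussBall hs.le (by positivity) _ _ fun i _ => gaussBall_mono ?_
      (smul_mem_gaussBall hs.le hx (by positivity) _
        (pow_mem_gaussBall hs.le hx hs.le (self_mem_gaussBall hs.le) i))
    rcases eq_or_ne i 1 with rfl | hi1
    · simp only [hc', if_true, norm_zero, zero_mul]
      positivity
    · simp only [hc', if_neg hi1]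
      rcases Nat.eq_zero_or_pos i with rfl | hi
      · simpa using hδ0
      · refine (norm_coeff_mul_pow_le hr hs.le hc hi).trans ?_
        obtain ⟨j, rfl⟩ : ∃ j, i = j + 1 := ⟨i - 1, by omega⟩
        have hj := mul_div_pow_le hr hs.le hsr.le (i := j) (by omega)
        calc r * (s / r) ^ (j + 1) = (s / r) * (r * (s / r) ^ j) := by ring
          _ ≤ δ * s := mul_le_mul hδ hj (by positivity) hδ'
  · have htail := (hasSum_nat_add_iff' M).mpr (hsum n)
    have hfin : ∑ i ∈ Finset.range M, c i * x n ^ i =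
        c 1 * x n + ∑ i ∈ Finset.range M, c' i * x n ^ i := by
      have h1 : (1 : ℕ) ∈ Finset.range M := Finset.mem_range.mpr (by omega)
      rw [← Finset.add_sum_erase _ _ h1, ← Finset.add_sum_erase _ (fun i => c' i * x n ^ i) h1]
      simp only [hc', if_true, zero_mul, zero_add, pow_one]
      congr 1
      exact Finset.sum_congr rfl fun i hi => by rw [if_neg (Finset.ne_of_mem_erase hi)]
    simp only [Finset.sum_apply, Pi.pow_apply]
    rw [sub_sub, ← hfin]
    refine norm_le_of_hasSum htail fun i => (norm_term_le (hx n) _).trans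
      ((norm_coeff_mul_pow_le hr hs.le hc (by omega)).trans ?_)
    have h1 : (s / r) ^ (i + M) ≤ (s / r) ^ N :=
      pow_le_pow_of_le_one (by positivity) hsr1.le (by omega)
    calc r * (s / r) ^ (i + M) ≤ r * (ε / r) := mul_le_mul_of_nonneg_left (h1.trans hN.le) hr.le
      _ = ε := mul_div_cancel₀ _ hr.ne'

/-- Induction on `k`: the next error is the shift of the previous one plus `a ^ k` times the first,
and neither operation enlarges the bound. -/
theorem shift_sub_pow_smul_mem_gaussBall {a : K} (ha : ‖a‖ = 1) (hs : 0 ≤ s)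
    (hx : ∀ n, ‖x n‖ ≤ s) (hδ0 : 0 ≤ δ) (hδ : δ ≤ 1)
    (h : (fun n => x (n + 1) - a * x n) ∈ gaussBall x s (δ * s)) (k : ℕ) :
    (fun n => x (n + k) - a ^ k * x n) ∈ gaussBall x s (δ * s) := by
  have hδs : 0 ≤ δ * s := by positivity
  have hax := smul_mem_gaussBall hs hx hs a (self_mem_gaussBall hs)
  rw [ha, one_mul] at hax
  have h1 : (fun n => x (n + 1)) ∈ gaussBall x s s := by
    have := add_mem_gaussBall hs (gaussBall_mono (mul_le_of_le_one_left hs hδ) h) hax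
    convert this using 1
    ext n
    simp
  induction k with
  | zero =>
    simp only [add_zero, pow_zero, one_mul, sub_self]
    exact zero_mem_gaussBall hδs
  | succ k ih =>
    have hk := smul_mem_gaussBall hs hx hδs (a ^ k) h
    rw [norm_pow, ha, one_pow, one_mul] at hk
    convert add_mem_gaussBall hs (shift_mem_gaussBall hs hx h1 hδs ih) hk using 1
    ext n
    simp only [Pi.add_apply]
    rw [add_right_comm n 1 k, add_assoc n k 1]
    ring

theorem exists_isContracting_of_powerSeries (hr : 0 < r) (hs : 0 < s) (hsr : s < r)
    (hc0 : ‖c 0‖ < s) (hc1 : ‖c 1‖ = 1) (hc : ∀ i, 1 ≤ i → ‖c i‖ * r ^ i ≤ r)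
    (hx : ∀ n, ‖x n‖ ≤ s) (hsum : ∀ n, HasSum (fun i => c i * x n ^ i) (x (n + 1)))
    {k : ℕ} (hk : 0 < k) (hck : ‖c 1 ^ k - 1‖ < 1) {p : ℕ} (hp0 : 0 < p) (hp : ‖(p : K)‖ < 1)
    {ρ : ℝ} (hρ : 0 < ρ) : ∃ k' > 0, IsContracting x s k' ρ := by
  set δ := max (‖c 0‖ / s) (s / r)
  have hδ1 : δ < 1 := max_lt ((div_lt_one hs).mpr hc0) ((div_lt_one hr).mpr hsr)
  have hδ0 : 0 ≤ δ := le_max_of_le_left (by positivity)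
  have h1 := shift_sub_pow_smul_mem_gaussBall hc1 hs.le hx hδ0 hδ1.le
    (shift_sub_smul_mem_gaussBall hr hs hsr hc hx hsum
      ((div_le_iff₀ hs).mp (le_max_left _ _)) (le_max_right _ _)) k
  -- The `k`-th iterate minus the identity is its deviation from `c 1 ^ k * t` plus `(c 1 ^ k - 1) *
  -- t`.
  set θ := max δ ‖c 1 ^ k - 1‖
  have hθ1 : θ < 1 := max_lt hδ1 hck
  have hθ0 : 0 ≤ θ := le_max_of_le_left hδ0
  have h2 : (fun n => x (n + k)) - x ∈ gaussBall x s (θ * s) := by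
    convert add_mem_gaussBall hs.le
      (gaussBall_mono (mul_le_mul_of_nonneg_right (le_max_left δ ‖c 1 ^ k - 1‖) hs.le) h1)
      (gaussBall_mono (mul_le_mul_of_nonneg_right (le_max_right δ ‖c 1 ^ k - 1‖) hs.le)
        (smul_mem_gaussBall hs.le hx hs.le (c 1 ^ k - 1) (self_mem_gaussBall hs.le))) using 1
    ext n
    simp only [Pi.add_apply, Pi.sub_apply]
    ring
  have h3 : (fun n => x (n + k)) ∈ gaussBall x s s := by
    convert add_mem_gaussBall hs.le
      (gaussBall_mono (mul_le_of_le_one_left hs.le hθ1.le) h2) (self_mem_gaussBall hs.le) using 1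
    simp
  exact (isContracting_of_sub_mem hs.le hx hθ0 h3 h2).exists_contracting_le hs.le hx hθ0 hθ1 hk
    hp0 hp hρ

end PowerSeriesOrbit

/-! ### Input specific to `ℂ_[p]` -/

section Padic

variable {p : ℕ} [Fact p.Prime]

/-- A unit of `ℂ_p` has a positive power that is congruent to `1` modulo the maximal ideal. -/
theorem exists_norm_pow_sub_one_lt (c : ℂ_[p]) (hc : ‖c‖ = 1) :
    ∃ k > 0, ‖c ^ k - 1‖ < 1 := by
  obtain ⟨y, hy⟩ : ∃ y : PadicAlgCl p, ‖c - (y : ℂ_[p])‖ < 1 := by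
    obtain ⟨y, hy⟩ := UniformSpace.Completion.denseRange_coe.exists_dist_lt c one_pos
    exact ⟨y, by rwa [← dist_eq_norm]⟩
  have hy1 : ‖y‖ = 1 := by
    rw [← PadicComplex.norm_extends, ← hc]
    by_contra hne
    have := IsUltrametricDist.norm_add_eq_max_of_norm_ne_norm
      (x := c) (y := -(y : ℂ_[p])) (by rw [norm_neg]; exact fun h => hne h.symm)
    rw [← sub_eq_add_neg] at this
    rw [this, hc] at hy
    exact absurd hy (not_lt.mpr (le_max_left _ _))
  -- `ℂ_[p]` is not locally compact, but all powers of the algebraic approximation `y` lie in this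
  -- finite-dimensional space. Bounded sets there are relatively compact, so two distinct powers are
  -- at distance less than 1, and their quotient is the desired power.
  set W := Subalgebra.toSubmodule (Algebra.adjoin ℚ_[p] {y})
  have : Module.Finite ℚ_[p] W := Module.Finite.of_fg
    (Algebra.IsIntegral.isIntegral (R := ℚ_[p]) y).fg_adjoin_singleton
  have : ProperSpace W := FiniteDimensional.proper ℚ_[p] W
  set u : ℕ → W := fun n => ⟨y ^ n, pow_mem (Algebra.self_mem_adjoin_singleton ℚ_[p] y) n⟩
  obtain ⟨w, -, φ, hφ, hlim⟩ := tendsto_subseq_of_bounded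
    (Metric.isBounded_closedBall (x := (0 : W)) (r := 1)) (x := u) fun n => by
      rw [mem_closedBall_zero_iff]
      change ‖y ^ n‖ ≤ 1
      simp [hy1]
  obtain ⟨N, hN⟩ := Metric.cauchySeq_iff'.mp hlim.cauchySeq 1 one_pos
  have hd := hN (N + 1) N.le_succ
  have hlt : φ N < φ (N + 1) := hφ N.lt_succ_self
  set k := φ (N + 1) - φ N
  have hk : φ (N + 1) = φ N + k := by omega
  refine ⟨k, by omega, ?_⟩
  have hyk : ‖y ^ k - 1‖ < 1 := by
    rw [dist_eq_norm] at hd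
    change ‖y ^ φ (N + 1) - y ^ φ N‖ < 1 at hd
    rwa [hk, pow_add, ← mul_sub_one, norm_mul, norm_pow, hy1, one_pow, one_mul] at hd
  have hpow : ‖c ^ k - (y : ℂ_[p]) ^ k‖ < 1 := by
    rw [← (Commute.all _ _).mul_geom_sum₂, norm_mul]
    refine mul_lt_one_of_nonneg_of_lt_one_left (norm_nonneg _) hy
      (IsUltrametricDist.norm_sum_le_of_forall_le_of_nonneg zero_le_one fun i _ => ?_)
    simp [hc, hy1]
  have hyk' : ‖(y : ℂ_[p]) ^ k - 1‖ < 1 := by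
    have : (y : ℂ_[p]) ^ k - 1 = ((y ^ k - 1 : PadicAlgCl p) : ℂ_[p]) := by
      simp [PadicComplex.coe_eq]
    rwa [this, PadicComplex.norm_extends]
  rw [← sub_add_sub_cancel _ ((y : ℂ_[p]) ^ k)]
  exact (IsUltrametricDist.norm_add_le_max _ _).trans_lt (max_lt hpow hyk')

theorem norm_natCast_padicComplex (n : ℕ) : ‖(n : ℂ_[p])‖ = ‖(n : ℚ_[p])‖ := by
  rw [← PadicComplex.norm_extends' p n]
  simp

/-- The crude bound `v_p(m!) ≤ m` suffices, since differences can be made to decay at any rate. -/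
theorem inv_pow_le_norm_factorial (m : ℕ) : ((p : ℝ)⁻¹) ^ m ≤ ‖(m.factorial : ℂ_[p])‖ := by
  have hp : (1 : ℝ) ≤ p := by exact_mod_cast (Fact.out : p.Prime).one_le
  rw [norm_natCast_padicComplex, Padic.norm_eq_zpow_neg_valuation
    (Nat.cast_ne_zero.mpr m.factorial_ne_zero), Padic.valuation_natCast, zpow_neg, zpow_natCast,
    inv_pow]
  exact inv_anti₀ (by positivity) (pow_le_pow_right₀ hp (padicValNat_factorial_le p m))

/-- In suitable affine coordinates, the iterates of a point of a quasiperiodicity disk have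
arbitrarily fast decaying differences along an arithmetic progression. -/
theorem IsQuasiperiodicityDisk.exists_isContracting {U : Set (P1 ℂ_[p])} {f : U → U}
    (hf : IsQuasiperiodicityDisk U f) (α : U) {ρ : ℝ} (hρ : 0 < ρ) :
    ∃ (γ : GL (Fin 2) ℂ_[p]) (x : ℕ → ℂ_[p]) (s : ℝ) (k : ℕ), 0 ≤ s ∧ (∀ n, ‖x n‖ ≤ s) ∧ 0 < k ∧
      IsContracting x s k ρ ∧ ∀ n, ((f^[n] α : U) : P1 ℂ_[p]) = γ • affinePoint (x n) := by
  obtain ⟨r, γ, c, hr, hU, hc0, hc1, hc, hstep⟩ := hf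
  obtain ⟨t₀, ht₀, hα⟩ : (α : P1 ℂ_[p]) ∈ openDisk γ r := hU ▸ α.2
  rw [mem_ball_zero_iff] at ht₀
  -- The closed ball of radius `s` contains the starting point and `c 0`, hence is stable; `s < r`
  -- is what provides the contraction.
  obtain ⟨s, hs, hsr⟩ := exists_between (max_lt ht₀ hc0)
  have hs0 : 0 < s := (norm_nonneg t₀).trans_lt ((le_max_left _ _).trans_lt hs)
  have hc0s : ‖c 0‖ < s := (le_max_right _ _).trans_lt hs
  set F : ℂ_[p] → ℂ_[p] := fun t => ∑' i, c i * t ^ i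
  set x : ℕ → ℂ_[p] := fun n => F^[n] t₀
  have key : ∀ u : U, ∀ t, ‖t‖ ≤ s → (u : P1 ℂ_[p]) = γ • affinePoint t →
      HasSum (fun i => c i * t ^ i) (F t) ∧ (f u : P1 ℂ_[p]) = γ • affinePoint (F t) := by
    intro u t ht hu
    obtain ⟨v, hv, hfu⟩ := hstep u t (ht.trans_lt hsr) hu
    rw [show F t = v from hv.tsum_eq]
    exact ⟨hv, hfu⟩
  have hx : ∀ n, ‖x n‖ ≤ s ∧ ((f^[n] α : U) : P1 ℂ_[p]) = γ • affinePoint (x n) := by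
    intro n
    induction n with
    | zero => exact ⟨((le_max_left _ _).trans_lt hs).le, hα.symm⟩
    | succ n ih =>
      obtain ⟨h1, h2⟩ := key _ _ ih.1 ih.2
      rw [show x (n + 1) = F (x n) from Function.iterate_succ_apply' F n t₀,
        Function.iterate_succ_apply']
      exact ⟨norm_powerSeries_le hr hs0.le hsr.le hc0s.le hc ih.1 h1, h2⟩
  have hsum : ∀ n, HasSum (fun i => c i * x n ^ i) (x (n + 1)) := fun n => by
    rw [show x (n + 1) = F (x n) from Function.iterate_succ_apply' F n t₀]
    exact (key _ _ (hx n).1 (hx n).2).1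
  obtain ⟨k₀, hk₀, hck⟩ := exists_norm_pow_sub_one_lt (c 1) hc1
  have hp := (Fact.out : p.Prime)
  have hpn : ‖(p : ℂ_[p])‖ < 1 := by
    rw [norm_natCast_padicComplex]
    exact Padic.norm_p_lt_one
  obtain ⟨k, hk, hkρ⟩ := exists_isContracting_of_powerSeries hr hs0 hsr hc0s hc1 hc
    (fun n => (hx n).1) hsum hk₀ hck hp.pos hpn hρ
  exact ⟨γ, x, s, k, hs0.le, fun n => (hx n).1, hk, hkρ, fun n => (hx n).2⟩

end Padic

/-! ### Equations in disk coordinates, progressions, and the theorem -/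

theorem vanishesAt_smul_affinePoint_iff {K : Type*} [Field K] {g : ℕ}
    {F : MvPolynomial (Fin g × Fin 2) K} {d : Fin g → ℕ} (hF : IsMultihomogeneous F d)
    (γ : Fin g → GL (Fin 2) K) (t : Fin g → K) :
    VanishesAt F (fun i => γ i • affinePoint (t i)) ↔
      MvPolynomial.eval (fun ij : Fin g × Fin 2 =>
        (γ ij.1).1 ij.2 0 * t ij.1 + (γ ij.1).1 ij.2 1) F = 0 := by
  have h := vanishesAt_mk_iff hF (fun i => γ i • ![t i, 1])
    fun i => (smul_ne_zero_iff_ne (γ i)).mpr (by simp)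
  have e : (fun ij : Fin g × Fin 2 => (γ ij.1 • ![t ij.1, 1]) ij.2) = fun ij =>
      (γ ij.1).1 ij.2 0 * t ij.1 + (γ ij.1).1 ij.2 1 := by
    ext ij
    change (γ ij.1).1.mulVec ![t ij.1, 1] ij.2 = _
    simp [Matrix.mulVec, dotProduct, Fin.sum_univ_two]
  rw [← e]
  exact h

/-- A set of natural numbers that is finite or full along each residue class modulo `k` is a
finite union of arithmetic progressions and singletons. -/
theorem exists_finset_progressions {Z : Set ℕ} {k : ℕ} (hk : 0 < k)
    (hZ : ∀ l, (∀ n, n * k + l ∈ Z) ∨ {n | n * k + l ∈ Z}.Finite) :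
    ∃ S : Finset (ℕ × ℕ), ∀ m, m ∈ Z ↔ ∃ kl ∈ S, ∃ n, m = n * kl.1 + kl.2 := by
  classical
  have hB : {m | m ∈ Z ∧ ¬ ∀ n, n * k + m % k ∈ Z}.Finite := by
    refine Set.Finite.subset (Set.Finite.biUnion
      ((Finset.range k).filter fun l => ¬ ∀ n, n * k + l ∈ Z).finite_toSet
      fun l hl => (((hZ l).resolve_left (Finset.mem_filter.mp hl).2).image fun n => n * k + l)) ?_
    rintro m ⟨hm, hml⟩
    simp only [Set.mem_iUnion]
    refine ⟨m % k, by simpa [Nat.mod_lt m hk] using hml, m / k, ?_, Nat.div_add_mod' m k⟩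
    simpa [Nat.div_add_mod'] using hm
  -- Step 0 encodes the finitely many exceptional singletons.
  refine ⟨((Finset.range k).filter fun l => ∀ n, n * k + l ∈ Z).image (Prod.mk k) ∪
    hB.toFinset.image (Prod.mk 0), fun m => ⟨fun hm => ?_, ?_⟩⟩
  · by_cases h : ∀ n, n * k + m % k ∈ Z
    · refine ⟨(k, m % k), ?_, m / k, (Nat.div_add_mod' m k).symm⟩
      exact Finset.mem_union_left _ (Finset.mem_image_of_mem _
        (Finset.mem_filter.mpr ⟨Finset.mem_range.mpr (Nat.mod_lt m hk), h⟩))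
    · exact ⟨(0, m), Finset.mem_union_right _ (Finset.mem_image_of_mem _
        (hB.mem_toFinset.mpr ⟨hm, h⟩)), 0, by simp⟩
  · rintro ⟨kl, hkl, n, rfl⟩
    simp only [Finset.mem_union, Finset.mem_image, Finset.mem_filter, Set.Finite.mem_toFinset,
      Set.mem_ofPred_eq] at hkl
    rcases hkl with ⟨l, hl, rfl⟩ | ⟨l, hl, rfl⟩
    · exact hl.2 n
    · simpa using hl.1

end

end PadicDynamics

theorem theorem3p2 (p : ℕ) [Fact p.Prime] (g : ℕ) (hg : 1 ≤ g)
    (U : Fin g → Set (PadicDynamics.P1 ℂ_[p])) (f : ∀ i, U i → U i)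
    (hf : ∀ i, PadicDynamics.IsQuasiperiodicityDisk (U i) (f i))
    (α : ∀ i, U i)
    (V : Set (Fin g → PadicDynamics.P1 ℂ_[p])) (hV : PadicDynamics.IsSubvariety V) :
    ∃ S : Finset (ℕ × ℕ),
      V ∩ PadicDynamics.orbit (Pi.map f) α =
        ⋃ kl ∈ S, PadicDynamics.suborbit (Pi.map f) α kl.1 kl.2 := by
  open PadicDynamics in
  have hp : (1 : ℝ) < p := by exact_mod_cast (Fact.out : p.Prime).one_lt
  set q : ℝ := (p : ℝ)⁻¹
  have hq : 0 < q := by positivity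
  have hq1 : q < 1 := inv_lt_one_of_one_lt₀ hp
  -- Any rate below `q = p⁻¹` would do; `q ^ 2` is one.
  choose γ x s k hs hx hk hρ hpt using fun i =>
    (hf i).exists_isContracting (α i) (ρ := q ^ 2) (by positivity)
  -- A common multiple of the steps: contraction passes to multiples, so one progression serves all
  -- factors.
  set kk := ∏ i, k i
  have hkk : 0 < kk := Finset.prod_pos fun i _ => hk i
  have hcontr : ∀ i, IsContracting (x i) (s i) kk (q ^ 2) := fun i => by
    obtain ⟨j, hj⟩ := Finset.dvd_prod_of_mem k (Finset.mem_univ i)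
    rw [show kk = j * k i by rw [mul_comm, ← hj]]
    exact (hρ i).mul_left (hs i) (by positivity) (pow_le_one₀ hq.le hq1.le) j
  obtain ⟨T, hT, rfl⟩ := hV
  set pt : ℕ → Fin g → P1 ℂ_[p] := fun m i => ((Pi.map f)^[m] α i : U i)
  have hptm : ∀ m, pt m = fun i => γ i • affinePoint (x i m) := fun m => by
    ext1 i
    rw [← hpt i m]
    simp [pt, Pi.map_iterate]
  obtain ⟨S, hS⟩ := exists_finset_progressions
    (Z := {m | ∀ F ∈ T, VanishesAt F (pt m)}) hkk fun l => by
      have hF : ∀ F ∈ T, (∀ n, VanishesAt F (pt (n * kk + l))) ∨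
          {n | VanishesAt F (pt (n * kk + l))}.Finite := by
        intro F hF
        obtain ⟨d, hd⟩ := hT F hF
        simp only [hptm, vanishesAt_smul_affinePoint_iff hd]
        have hρ0 : 0 ≤ q ^ 2 := by positivity
        have hcoord : ∀ ij : Fin g × Fin 2, DiffDecay (q ^ 2) fun n =>
            (γ ij.1).1 ij.2 0 * x ij.1 (n * kk + l) + (γ ij.1).1 ij.2 1 := fun ij => by
          have h1 : DiffDecay (q ^ 2) fun n => x ij.1 (n * kk + l) :=
            (hcontr ij.1).diffDecay (hs _) (hx _) hρ0 l
          exact ((DiffDecay.const hρ0 ((γ ij.1).1 ij.2 0)).mul hρ0 h1).add hρ0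
            (DiffDecay.const hρ0 ((γ ij.1).1 ij.2 1))
        exact (DiffDecay.mvPolynomial_eval hρ0 hcoord F).eq_zero_or_finite_zeros hq
          inv_pow_le_norm_factorial hρ0 (by nlinarith)
      -- A single equation failing somewhere on the class already makes the common zeros finite, so
      -- `T` may be infinite.
      by_cases h : ∀ F ∈ T, ∀ n, VanishesAt F (pt (n * kk + l))
      · exact Or.inl fun n F hF => h F hF n
      · push Not at h
        obtain ⟨F, hFT, n, hn⟩ := h
        exact Or.inr (((hF F hFT).resolve_left fun h => hn (h n)).subset fun n hn => hn F hFT)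
  refine ⟨S, Set.ext fun P => ?_⟩
  simp only [Set.mem_iUnion]
  constructor
  · rintro ⟨hP, m, rfl⟩
    obtain ⟨kl, hkl, n, hn⟩ := (hS m).mp hP
    exact ⟨kl, hkl, n, by rw [hn]⟩
  · rintro ⟨kl, hkl, n, rfl⟩
    exact ⟨(hS _).mpr ⟨kl, hkl, n, rfl⟩, _, rfl⟩
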